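/- Conventions. All cardinals called regular are infinite, and diagrams are small. A *left-proper factorization system* in a category $\mathcal A$ is a pair $(\mathcal E,\mathcal M)$ of classes of morphisms, each containing all isomorphisms and closed under composition, such that every $\mathcal E$-morphism is an epimorphism, every morphism $f$ has a factorization $f=m\cdot e$ with $e\in\mathcal E$, $m\in\mathcal M$, and for any other such factorization $f=m'\cdot e'$ there is a unique $d$ with $d\cdot e=e'$ and $m'\cdot d=m$. For a regular cardinal $\lambda$, an object $A$ *has $\mathcal M$-rank $\lambda$* if $\hom(A,-)$ preserves $\lambda$-filtered colimits of diagrams whose connecting morphisms lie in $\mathcal M$, and $A$ has fewer than $\lambda$ $\mathcal E$-quotients (isomorphism classes of $\mathcal E$-morphisms with domain $A$). A category $\mathcal A$ is *strongly locally ranked* if it has a left-proper factorization system $(\mathcal E,\mathcal M)$ such that: (i) $\mathcal A$ is cocomplete; (ii) every object has an $\mathcal M$-rank, and for every regular cardinal $\mu$ the objects of $\mathcal M$-rank $\mu$ form a set up to isomorphism; (iii) for every regular cardinal $\mu$ the objects of $\mathcal M$-rank $\mu$ are closed under $\mathcal E$-quotients and under colimits of diagrams with fewer than $\mu$ morphisms;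 (iv) for every colimit of a filtered diagram whose connecting morphisms lie in $\mathcal M$, the colimit cocone consists of $\mathcal M$-morphisms, and the factorizing morphism of any other cocone of $\mathcal M$-morphisms lies in $\mathcal M$. An object $X$ is *injective with respect to* $h\colon A\to B$ if every $f\colon A\to X$ is of the form $f=g\cdot h$ for some $g\colon B\to X$. For a set $\mathcal H$ of morphisms, $\mathcal H\models h$ means that every object injective with respect to all members of $\mathcal H$ is injective with respect to $h$. The *Injectivity Deduction System* has the following rules. - Cancellation: from $h'\cdot h$ derive $h$. - Pushout: from $h$ derive $h'$, whenever $h'$ is opposite to $h$ in a pushout square (along an arbitrary morphism). - Transfinite composition, for every ordinal $\lambda$: from $h_i$ $(i<\lambda)$ derive $h$, whenever $h$ is a $\lambda$-composite of $(h_i)_{i<\lambda}$, i.e. there is a functor $A$ from the well-ordered set $\{i\mid i\le\lambda\}$ with connecting morphisms $a_{ij}\colon A_i\to A_j$ such that $A_i=\operatorname{colim}_{j<i}A_j$ (with cocone $(a_{ji})_{j<i}$) for every limit ordinal $i\le\lambda$, $h_i=a_{i,i+1}$ for all $i<\lambda$, and $h=a_{0,\lambda}$. (For $\lambda=0$ this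 derives every identity morphism without premises.) Write $\mathcal H\vdash h$ if there is a proof of $h$ from $\mathcal H$: an ordinal $n$ and a chain $(h_i)_{i\le n}$ of morphisms with $h_n=h$ such that each $h_i$ lies in $\mathcal H$ or is the conclusion of one of the deduction rules with all premises in $\{h_j\mid j<i\}$. **Corollary.** Let $\mathcal A$ be a strongly locally ranked category. The Injectivity Logic is sound and complete in $\mathcal A$: for every set $\mathcal H$ of morphisms of $\mathcal A$ and every morphism $h$ of $\mathcal A$, $$\mathcal H\models h\iff\mathcal H\vdash h .$$ -/

import Mathlib

open CategoryTheory CategoryTheory.Limits Opposite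

universe v u

namespace InjectivityLogic

variable {C : Type u} [Category.{v} C]

/-! ### Factorization systems, ranks and strongly locally ranked categories -/

/-- A left-proper factorization system `(E, M)`: both classes contain all isomorphisms and are
closed under composition, every morphism factors as an `E`-morphism followed by an `M`-morphism,
any two such factorizations of a morphism are related by a unique diagonal fill-in, and every
`E`-morphism is an epimorphism. -/
structure IsLeftProperFactorizationSystem (E M : MorphismProperty C) : Prop where
  left_of_isIso : ∀ ⦃X Y : C⦄ (f : X ⟶ Y), IsIso f → E f
  right_of_isIso : ∀ ⦃X Y : C⦄ (f : X ⟶ Y), IsIso f → M f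
  left_comp : ∀ ⦃X Y Z : C⦄ (f : X ⟶ Y) (g : Y ⟶ Z), E f → E g → E (f ≫ g)
  right_comp : ∀ ⦃X Y Z : C⦄ (f : X ⟶ Y) (g : Y ⟶ Z), M f → M g → M (f ≫ g)
  factor : ∀ ⦃A B : C⦄ (f : A ⟶ B),
    ∃ (X : C) (e : A ⟶ X) (m : X ⟶ B), E e ∧ M m ∧ e ≫ m = f
  diagonal : ∀ ⦃A B X X' : C⦄ (e : A ⟶ X) (m : X ⟶ B) (e' : A ⟶ X') (m' : X' ⟶ B),
    E e → M m → E e' → M m' → e ≫ m = e' ≫ m' →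
      ∃! d : X ⟶ X', e ≫ d = e' ∧ d ≫ m' = m
  left_epi : ∀ ⦃X Y : C⦄ (f : X ⟶ Y), E f → Epi f

/-- The `E`-quotients of `A`: morphisms in `E` with domain `A`, up to isomorphism under `A`. -/
def Quotients (E : MorphismProperty C) (A : C) : Type (max u v) :=
  Quotient (isIsomorphicSetoid (ObjectProperty.FullSubcategory fun f : Under A => E f.hom))

/-- The object `A` has `M`-rank `κ`, for a regular cardinal `κ`: the functor `hom(A, -)` preserves
`κ`-filtered colimits of (small) diagrams whose connecting morphisms lie in `M`, and `A` has
fewer than `κ` `E`-quotients. -/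
structure HasRank (E M : MorphismProperty C) (κ : Cardinal.{v}) [Fact κ.IsRegular] (A : C) :
    Prop where
  preserves : ∀ (J : Type v) [SmallCategory J] [IsCardinalFiltered J κ] (F : J ⥤ C),
    (∀ ⦃i j : J⦄ (f : i ⟶ j), M (F.map f)) → PreservesColimit F (coyoneda.obj (op A))
  quotients_lt : HasCardinalLT (Quotients E A) κ

/-- The conditions which a left-proper factorization system `(E, M)` of a category has to satisfy
in order to witness that the category is strongly locally ranked. -/
structure IsStrongRanking (E M : MorphismProperty C) : Prop where
  leftProper : IsLeftProperFactorizationSystem E M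
  cocomplete : HasColimitsOfSize.{v, v} C
  exists_rank : ∀ A : C, ∃ (κ : Cardinal.{v}) (_ : Fact κ.IsRegular), HasRank E M κ A
  /-- The objects of a given rank form a set up to isomorphism. -/
  essentiallySmall : ∀ (κ : Cardinal.{v}) [Fact κ.IsRegular],
    ObjectProperty.EssentiallySmall.{v} (fun A : C => HasRank E M κ A)
  rank_quotient : ∀ (κ : Cardinal.{v}) [Fact κ.IsRegular] ⦃A B : C⦄ (e : A ⟶ B),
    E e → HasRank E M κ A → HasRank E M κ B
  /-- The objects of rank `κ` are closed under colimits of diagrams with fewer than `κ`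
  morphisms. -/
  rank_colimit : ∀ (κ : Cardinal.{v}) [Fact κ.IsRegular] (J : Type v) [SmallCategory J],
    HasCardinalLT (Arrow J) κ → ∀ (F : J ⥤ C) (c : Cocone F), IsColimit c →
      (∀ j, HasRank E M κ (F.obj j)) → HasRank E M κ c.pt
  /-- The subcategory of all objects and all `M`-morphisms is closed under filtered colimits:
  the colimit cocone of a filtered diagram of `M`-morphisms consists of `M`-morphisms, ... -/
  filtered_ι : ∀ (J : Type v) [SmallCategory J] [IsFiltered J] (F : J ⥤ C),
    (∀ ⦃i j : J⦄ (f : i ⟶ j), M (F.map f)) →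
      ∀ (c : Cocone F), IsColimit c → ∀ j, M (c.ι.app j)
  /-- ... and the factorizing morphism of any other cocone of `M`-morphisms lies in `M`. -/
  filtered_desc : ∀ (J : Type v) [SmallCategory J] [IsFiltered J] (F : J ⥤ C),
    (∀ ⦃i j : J⦄ (f : i ⟶ j), M (F.map f)) →
      ∀ (c : Cocone F) (hc : IsColimit c) (s : Cocone F),
        (∀ j, M (s.ι.app j)) → M (hc.desc s)

/-- A category is strongly locally ranked if it has a left-proper factorization system `(E, M)`
with the properties listed in `IsStrongRanking`. Here "small" refers to the universe `v` of the
hom-sets. -/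
def StronglyLocallyRanked (C : Type u) [Category.{v} C] : Prop :=
  ∃ E M : MorphismProperty C, IsStrongRanking E M

/-! ### Injectivity consequence -/

/-- The object `X` is injective with respect to `h : A ⟶ B`. -/
def InjectiveWrt {A B : C} (h : A ⟶ B) (X : C) : Prop :=
  ∀ f : A ⟶ X, ∃ g : B ⟶ X, h ≫ g = f

/-- `H ⊨ h`: every object injective with respect to all morphisms of `H` is injective with
respect to `h`. -/
def InjectivityConsequence (H : MorphismProperty C) {A B : C} (h : A ⟶ B) : Prop :=
  ∀ X : C, (∀ ⦃P Q : C⦄ (k : P ⟶ Q), H k → InjectiveWrt k X) → InjectiveWrt h X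

/-! ### The injectivity deduction system -/

/-- `Deduction P h` says that `h` is the conclusion of (one application of) one of the three
deduction rules, all of whose premises lie in the class `P`.

For transfinite composition, `J` is a small well-ordered set with a least element `⊥` and a
greatest element `⊤`: up to isomorphism, these are exactly the ordinals `λ + 1 = {i | i ≤ λ}`, and
`⊥`, `⊤` are `0`, `λ`. A functor `F` from `J` which is well-order-continuous is a smooth
`(λ + 1)`-chain; the pairs `i ⋖ j` are the pairs `(i, i + 1)` with `i < λ`. -/
inductive Deduction (P : MorphismProperty C) : MorphismProperty C
  | cancellation {X Y Z : C} (h : X ⟶ Y) (h' : Y ⟶ Z) (hP : P (h ≫ h')) : Deduction P h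
  | pushout {A A' B B' : C} (h : A ⟶ A') (u : A ⟶ B) (w : A' ⟶ B') (h' : B ⟶ B')
      (sq : IsPushout h u w h') (hP : P h) : Deduction P h'
  | transfiniteComposition (J : Type v) [LinearOrder J] [WellFoundedLT J] [OrderBot J] [OrderTop J]
      (F : J ⥤ C) [F.IsWellOrderContinuous]
      (hP : ∀ (i j : J) (hij : i ⋖ j), P (F.map (homOfLE hij.le))) :
      Deduction P (F.map (homOfLE (bot_le : (⊥ : J) ≤ ⊤)))

/-- A proof of `h` from `H`: a chain `(s i)` of morphisms, indexed by `{i | i ≤ n}` for an ordinal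
`n` (that is, by a small well-ordered set `I` with a greatest element), whose last member is
`h` and each member of which lies in `H` or is the conclusion of a deduction rule whose premises
are among the preceding members of the chain. -/
structure IsProof (H : MorphismProperty C) {A B : C} (h : A ⟶ B) (I : Type v) [LinearOrder I]
    [WellFoundedLT I] [OrderTop I] (s : I → Arrow C) : Prop where
  last : s ⊤ = Arrow.mk h
  step : ∀ i : I, H (s i).hom ∨
    Deduction (fun _ _ k => ∃ j : I, j < i ∧ s j = Arrow.mk k) (s i).hom

/-- `H ⊢ h`: there is a proof of `h` from `H` in the injectivity logic. -/
def FormalConsequence (H : MorphismProperty C) {A B : C} (h : A ⟶ B) : Prop :=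
  ∃ (I : Type v) (_ : LinearOrder I) (_ : WellFoundedLT I) (_ : OrderTop I) (s : I → Arrow C),
    IsProof H h I s

end InjectivityLogic

-- Soundness: for a fixed object `X`, the morphisms to which `X` is injective are closed under the
-- three rules, so induction along a proof suffices.
--
-- Completeness: it is enough to find, for the domain `A` of `h`, a deducible `t : A ⟶ X` with `X`
-- injective to all of `H`. Then `H ⊨ h` gives `t = h ≫ g`, and cancellation yields `h`. Such a `t`
-- is a transfinite composite of `κ` steps (`IsStrongRanking.exists_deducible_to_injective`), each
-- adjoining extensions of all maps from domains of members of `H`. A map `P ⟶ X` should factor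
-- through an earlier stage, but rank controls only colimits of `M`-morphisms, and the links need
-- not lie in `M`. The remedy is to make each step absorb every `E`-quotient of its domain that any
-- deducible morphism can produce (`IsStrongRanking.exists_isStableStep`). The `E`-images of the
-- steps then form a chain in `M`, interleaved with the original one and with the same colimit
-- (`exists_factor_through_stable_quotient`).

universe w

namespace InjectivityLogic

variable {C : Type u} [Category.{v} C]

/-! ### Soundness -/

section Soundness

variable {X : C}

lemma InjectiveWrt.of_chain (J : Type v) [LinearOrder J] [WellFoundedLT J] [OrderBot J] [OrderTop J]
    (F : J ⥤ C) [F.IsWellOrderContinuous]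
    (hF : ∀ (i j : J) (hij : i ⋖ j), InjectiveWrt (F.map (homOfLE hij.le)) X) :
    InjectiveWrt (F.map (homOfLE (bot_le : (⊥ : J) ≤ ⊤))) X := by
  let : SuccOrder J := SuccOrder.ofLinearWellFoundedLT J
  let G : Jᵒᵖ ⥤ Type v := F.op ⋙ yoneda.obj X
  -- In the inverse system of the sets `hom(F j, X)`, elements lift along each link by injectivity
  -- and glue at limits because `F` is continuous there.
  have d : G.WellOrderInductionData := .ofExists
    (fun j hj f => hF j (Order.succ j) (Order.covBy_succ_of_not_isMax hj) f)
    (fun j hj x => by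
      let c : Cocone ((Set.principalSegIio j).monotone.functor ⋙ F) :=
        { pt := X
          ι :=
            { app := fun i => x.val (op i)
              naturality := fun i i' φ => by
                exact (x.property φ.op).trans (Category.comp_id _).symm } }
      exact ⟨(F.isColimitOfIsWellOrderContinuous j hj).desc c,
        fun i hi => (F.isColimitOfIsWellOrderContinuous j hj).fac c ⟨i, hi⟩⟩)
  intro f
  obtain ⟨s, hs⟩ := d.surjective f
  exact ⟨s.val (op ⊤), (s.property (homOfLE (bot_le : (⊥ : J) ≤ ⊤)).op).trans hs⟩

lemma InjectiveWrt.of_deduction {P : MorphismProperty C}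
    (hP : ∀ ⦃A B : C⦄ (k : A ⟶ B), P k → InjectiveWrt k X) {A B : C} {k : A ⟶ B}
    (hk : Deduction P k) : InjectiveWrt k X := by
  cases hk with
  | cancellation _ h' h =>
    intro f
    obtain ⟨g, hg⟩ := hP _ h f
    exact ⟨h' ≫ g, by simpa using hg⟩
  | pushout h u w h' sq h =>
    intro f
    obtain ⟨g, hg⟩ := hP _ h (u ≫ f)
    exact ⟨sq.desc g f hg, sq.inr_desc _ _ _⟩
  | transfiniteComposition J F h =>
    exact .of_chain J F fun i j hij => hP _ (h i j hij)

lemma FormalConsequence.injectivityConsequence {H : MorphismProperty C} {A B : C} {h : A ⟶ B}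
    (hh : FormalConsequence H h) : InjectivityConsequence H h := by
  obtain ⟨I, _, _, _, s, hs⟩ := hh
  intro X hX
  have key : ∀ i : I, InjectiveWrt (s i).hom X := by
    intro i
    induction i using WellFoundedLT.induction with
    | ind i ih =>
      rcases hs.step i with hi | hi
      · exact hX _ hi
      · refine .of_deduction ?_ hi
        rintro P Q k ⟨j, hj, hjk⟩
        have := ih j hj
        rw [hjk] at this
        exact this
  have := key ⊤
  rw [hs.last] at this
  exact this

end Soundness

/-! ### Closure properties of the deducible morphisms -/

lemma Deduction.mono {P Q : MorphismProperty C} (h : P ≤ Q) : Deduction P ≤ Deduction Q := by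
  intro A B k hk
  cases hk with
  | cancellation _ g hP => exact .cancellation _ g (h _ hP)
  | pushout f u w _ sq hP => exact .pushout f u w _ sq (h _ hP)
  | transfiniteComposition J F hP =>
    exact .transfiniteComposition J F fun i j hij => h _ (hP i j hij)

/-- Every deduction uses only a small family of premises. -/
lemma Deduction.exists_small {P : MorphismProperty C} {A B : C} {k : A ⟶ B} (hk : Deduction P k) :
    ∃ (K : Type v) (p : K → Arrow C), (∀ a, P (p a).hom) ∧
      Deduction (fun _ _ q => ∃ a, p a = Arrow.mk q) k := by
  cases hk with
  | cancellation _ g hP =>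
    exact ⟨PUnit, fun _ => Arrow.mk (k ≫ g), fun _ => hP, .cancellation _ g ⟨⟨⟩, rfl⟩⟩
  | pushout h u w h' sq hP =>
    exact ⟨PUnit, fun _ => Arrow.mk h, fun _ => hP, .pushout h u w _ sq ⟨⟨⟩, rfl⟩⟩
  | transfiniteComposition J F hP =>
    exact ⟨{ p : J × J // p.1 ⋖ p.2 }, fun p => Arrow.mk (F.map (homOfLE p.2.le)),
      fun p => hP _ _ p.2, .transfiniteComposition J F fun i j hij => ⟨⟨(i, j), hij⟩, rfl⟩⟩

variable {H : MorphismProperty C}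

lemma FormalConsequence.of_mem {A B : C} {k : A ⟶ B} (hk : H k) : FormalConsequence H k :=
  ⟨PUnit, inferInstance, inferInstance, inferInstance, fun _ => Arrow.mk k, rfl,
    fun _ => Or.inl hk⟩

/-- The class of all morphisms deducible from `H`. -/
def deducible (H : MorphismProperty C) : MorphismProperty C := fun _ _ k => FormalConsequence H k

/-- Proofs of the premises, of which a small family suffices, are concatenated along a well-order (a
lexicographic sum), and the conclusion is put on top. -/
lemma deducible_of_deduction {A B : C} {k : A ⟶ B} (hk : Deduction (deducible H) k) :
    deducible H k := by
  obtain ⟨K, p, hp, hk⟩ := hk.exists_small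
  choose I oI wI tI s hs using hp
  obtain ⟨_, _⟩ := exists_wellFoundedLT K
  let Z := Σₗ a : K, I a
  have : WellFoundedLT Z := by
    refine ⟨⟨?_⟩⟩
    rintro ⟨a, i⟩
    induction a using WellFoundedLT.induction with
    | ind a iha =>
      induction i using WellFoundedLT.induction with
      | ind i ihi =>
        refine ⟨_, ?_⟩
        rintro ⟨b, j⟩ h
        rcases h with ⟨_, _, h⟩ | ⟨_, _, h⟩
        · exact iha b h j
        · exact ihi j h
  refine ⟨WithTop Z, inferInstance, inferInstance, inferInstance,
    fun z => z.recTopCoe (Arrow.mk k) (fun z => s (ofLex z).1 (ofLex z).2), rfl, ?_⟩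
  intro z
  induction z using WithTop.recTopCoe with
  | top =>
    refine Or.inr (Deduction.mono ?_ _ hk)
    rintro A B q ⟨a, ha⟩
    exact ⟨((toLex ⟨a, ⊤⟩ : Z) : WithTop Z), WithTop.coe_lt_top _, ((hs a).last).trans ha⟩
  | coe z =>
    obtain ⟨a, i⟩ := z
    rcases (hs a).step i with h | h
    · exact Or.inl h
    · refine Or.inr (Deduction.mono ?_ _ h)
      rintro A B q ⟨j, hj, hjq⟩
      exact ⟨((toLex ⟨a, j⟩ : Z) : WithTop Z), WithTop.coe_lt_coe.2 (Sigma.Lex.right _ _ hj), hjq⟩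

lemma deducible_cancel {X Y Z : C} {f : X ⟶ Y} {g : Y ⟶ Z} (h : deducible H (f ≫ g)) :
    deducible H f :=
  deducible_of_deduction (.cancellation f g h)

lemma deducible_pushout {A A' B B' : C} {h : A ⟶ A'} {u : A ⟶ B} {w : A' ⟶ B'} {h' : B ⟶ B'}
    (sq : IsPushout h u w h') (hh : deducible H h) : deducible H h' :=
  deducible_of_deduction (.pushout h u w h' sq hh)

lemma deducible_chain (J : Type v) [LinearOrder J] [WellFoundedLT J] [OrderBot J] [OrderTop J]
    (F : J ⥤ C) [F.IsWellOrderContinuous]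
    (hF : ∀ (i j : J) (hij : i ⋖ j), deducible H (F.map (homOfLE hij.le))) :
    deducible H (F.map (homOfLE (bot_le : (⊥ : J) ≤ ⊤))) :=
  deducible_of_deduction (.transfiniteComposition J F hF)

lemma deducible_id (X : C) : deducible H (𝟙 X) := by
  have : (((Functor.const PUnit.{v+1}).obj X)).IsWellOrderContinuous :=
    ⟨fun m hm => (hm.not_isMin (fun _ _ => le_rfl)).elim⟩
  exact deducible_chain PUnit ((Functor.const _).obj X)
    (fun i j hij => (hij.lt.ne rfl).elim)

lemma deducible_of_isIso {X Y : C} (f : X ⟶ Y) [IsIso f] : deducible H f :=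
  deducible_cancel (g := inv f) (by simpa using deducible_id X)

instance : (deducible H).RespectsIso := by
  refine MorphismProperty.RespectsIso.of_respects_arrow_iso _ fun f g e hf => ?_
  have : IsIso e.hom.left := inferInstanceAs (IsIso ((Arrow.leftFunc.mapIso e).hom))
  have : IsIso e.hom.right := inferInstanceAs (IsIso ((Arrow.rightFunc.mapIso e).hom))
  -- A commutative square with two opposite sides invertible is a pushout.
  exact deducible_pushout (IsPushout.of_vert_isIso (f := f.hom) (g := e.hom.left) ⟨e.hom.w.symm⟩) hf

lemma deducible_of_transfiniteCompositionOfShape (J : Type v) [LinearOrder J] [SuccOrder J]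
    [OrderBot J] [OrderTop J] [WellFoundedLT J] {X Y : C} {f : X ⟶ Y}
    (t : (deducible H).TransfiniteCompositionOfShape J f) : deducible H f := by
  have ht : deducible H (t.F.map (homOfLE (bot_le : (⊥ : J) ≤ ⊤))) := by
    refine deducible_chain J t.F fun i j hij => ?_
    obtain rfl := hij.succ_eq
    exact t.map_mem i hij.lt.not_isMax
  have : IsIso (t.incl.app ⊤) := t.isColimit.isIso_ι_app_of_isTerminal ⊤ isTerminalTop
  refine ((deducible H).arrow_mk_iso_iff (Arrow.isoMk t.isoBot (asIso (t.incl.app ⊤)) ?_)).1 ht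
  have h₁ := t.incl.naturality (homOfLE (bot_le : (⊥ : J) ≤ ⊤))
  have h₂ : t.isoBot.hom ≫ f = t.incl.app ⊥ := (Iso.inv_comp_eq _).1 t.fac |>.symm
  exact h₂.trans ((Category.comp_id _).symm.trans h₁.symm)

instance : (deducible H).IsMultiplicative where
  id_mem := deducible_id
  comp_mem f g hf hg := by
    -- A binary composite is a chain with three objects; its index set has to live in universe `v`.
    let : OrderTop (Shrink.{v} (Fin 3)) :=
      { top := orderIsoShrink.{v} (Fin 3) ⊤
        le_top := fun a => (orderIsoShrink.{v} (Fin 3)).symm_apply_le.1 le_top }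
    exact deducible_of_transfiniteCompositionOfShape _
      ((MorphismProperty.TransfiniteCompositionOfShape.ofComp f g hf hg).ofOrderIso
        (orderIsoShrink.{v} (Fin 3)).symm)

/-- The morphisms between arbitrary members of a smooth chain of deducible morphisms are
deducible. -/
lemma deducible_chain_map (J : Type v) [LinearOrder J] [WellFoundedLT J] [SuccOrder J] [OrderBot J]
    [OrderTop J] (F : J ⥤ C) [F.IsWellOrderContinuous]
    (hF : ∀ (j : J), ¬ IsMax j → deducible H (F.map (homOfLE (Order.le_succ j))))
    {i j : J} (hij : i ≤ j) : deducible H (F.map (homOfLE hij)) := by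
  let t : (deducible H).TransfiniteCompositionOfShape J
      (F.map (homOfLE (bot_le : (⊥ : J) ≤ ⊤))) :=
    { F := F
      isoBot := Iso.refl _
      incl :=
        { app := fun i => F.map (homOfLE le_top)
          naturality := fun i i' φ =>
            (F.map_comp φ (homOfLE le_top)).symm.trans (Category.comp_id _).symm }
      isColimit := colimitOfDiagramTerminal isTerminalTop F
      fac := by simp
      map_mem := hF }
  exact deducible_of_transfiniteCompositionOfShape _ ((t.iic j).ici ⟨i, hij⟩)

/-! ### Amalgamation of small families of deducible morphisms -/

section Amalgamation

variable [HasColimitsOfSize.{v, v} C] {X : C} {J : Type v} [LinearOrder J] {Y : J → C}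
  (f : ∀ j, X ⟶ Y j)

/-- The chain of the wide pushouts of the initial subfamilies of a well-ordered family of
morphisms with common domain. -/
noncomputable def widePushoutChain : J ⥤ C where
  obj j := widePushout X (fun i : Set.Iio j => Y i) (fun i => f i)
  map {j k} φ := WidePushout.desc (WidePushout.head _)
    (fun i => WidePushout.ι (fun i : Set.Iio k => f i) ⟨i, i.2.trans_le (leOfHom φ)⟩)
    (fun i => WidePushout.arrow_ι (fun i : Set.Iio k => f i) ⟨i, i.2.trans_le (leOfHom φ)⟩)
  map_id j := by
    apply WidePushout.hom_ext
    · intro i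
      exact (WidePushout.ι_desc _ _ _ _ _).trans (Category.comp_id _).symm
    · exact (WidePushout.head_desc _ _ _ _).trans (Category.comp_id _).symm
  map_comp {j k l} φ ψ := by
    apply WidePushout.hom_ext
    · intro i
      rw [WidePushout.ι_desc, WidePushout.ι_desc_assoc]
      exact (WidePushout.ι_desc (fun i : Set.Iio k => f i) _
        (fun i => WidePushout.ι (fun i : Set.Iio l => f i) ⟨i, i.2.trans_le (leOfHom ψ)⟩) _
        ⟨i, i.2.trans_le (leOfHom φ)⟩).symm
    · rw [WidePushout.head_desc, WidePushout.head_desc_assoc, WidePushout.head_desc]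

namespace widePushoutChain

/-- The morphism from the common domain to a member of the chain. -/
noncomputable def head (j : J) : X ⟶ (widePushoutChain f).obj j :=
  WidePushout.head (fun i : Set.Iio j => f i)

/-- The morphism from a member of the family to a later member of the chain. -/
noncomputable def ι {i j : J} (hij : i < j) : Y i ⟶ (widePushoutChain f).obj j :=
  WidePushout.ι (fun i : Set.Iio j => f i) ⟨i, hij⟩

@[simp]
lemma hom_ι {i j : J} (hij : i < j) : f i ≫ ι f hij = head f j :=
  WidePushout.arrow_ι (fun i : Set.Iio j => f i) ⟨i, hij⟩

@[simp]
lemma head_map {j k : J} (φ : j ⟶ k) : head f j ≫ (widePushoutChain f).map φ = head f k :=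
  WidePushout.head_desc _ _ _ _

@[simp]
lemma ι_map {i j k : J} (hij : i < j) (φ : j ⟶ k) :
    ι f hij ≫ (widePushoutChain f).map φ = ι f (hij.trans_le (leOfHom φ)) :=
  WidePushout.ι_desc _ _ _ _ _

@[simp]
lemma hom_ι_assoc {i j : J} (hij : i < j) {T : C} (g : (widePushoutChain f).obj j ⟶ T) :
    f i ≫ ι f hij ≫ g = head f j ≫ g := by
  rw [← Category.assoc, hom_ι]

@[simp]
lemma head_map_assoc {j k : J} (φ : j ⟶ k) {T : C} (g : (widePushoutChain f).obj k ⟶ T) :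
    head f j ≫ (widePushoutChain f).map φ ≫ g = head f k ≫ g := by
  rw [← Category.assoc, head_map]

@[simp]
lemma ι_map_assoc {i j k : J} (hij : i < j) (φ : j ⟶ k) {T : C}
    (g : (widePushoutChain f).obj k ⟶ T) :
    ι f hij ≫ (widePushoutChain f).map φ ≫ g = ι f (hij.trans_le (leOfHom φ)) ≫ g := by
  rw [← Category.assoc, ι_map]

variable {f}

lemma hom_ext {j : J} {T : C} {p q : (widePushoutChain f).obj j ⟶ T}
    (h₀ : head f j ≫ p = head f j ≫ q)
    (h : ∀ (i : J) (hi : i < j), ι f hi ≫ p = ι f hi ≫ q) : p = q :=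
  WidePushout.hom_ext _ _ _ (fun i => h i i.2) h₀

lemma exists_desc {j : J} {T : C} (a : X ⟶ T) (b : ∀ i < j, Y i ⟶ T)
    (hb : ∀ i hi, f i ≫ b i hi = a) :
    ∃ d : (widePushoutChain f).obj j ⟶ T, head f j ≫ d = a ∧
      ∀ (i : J) (hi : i < j), ι f hi ≫ d = b i hi :=
  ⟨WidePushout.desc a (fun i => b i i.2) fun i => hb i i.2, WidePushout.head_desc _ _ _ _,
    fun i hi => WidePushout.ι_desc _ _ _ _ (⟨i, hi⟩ : Set.Iio j)⟩

/-- Since `i ⋖ j`, the only index below `j` that is not below `i` is `i` itself, so the link adjoins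
just the leg `f i`. -/
lemma isPushout_map {i j : J} (hij : i ⋖ j) :
    IsPushout (f i) (head f i) (ι f hij.lt) ((widePushoutChain f).map (homOfLE hij.le)) := by
  have key (s : PushoutCocone (f i) (head f i)) :
      ∃ d : (widePushoutChain f).obj j ⟶ s.pt, ι f hij.lt ≫ d = s.inl ∧
        (widePushoutChain f).map (homOfLE hij.le) ≫ d = s.inr := by
    obtain ⟨d, hd₀, hd⟩ := exists_desc (f := f) (j := j) (head f i ≫ s.inr)
      (fun k hk => if h : k = i then eqToHom (by rw [h]) ≫ s.inl else
        ι f (lt_of_le_of_ne (hij.le_of_lt hk) h) ≫ s.inr)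
      (by
        intro k hk
        by_cases h : k = i
        · subst h
          simpa using s.condition
        · simp [h])
    refine ⟨d, by simp [hd], hom_ext (by simpa using hd₀) fun k hk => ?_⟩
    simp [hd, hk.ne]
  choose d hd₁ hd₂ using key
  refine ⟨⟨by simp⟩, ⟨PushoutCocone.IsColimit.mk _ d hd₁ hd₂ fun s m h₁ h₂ => ?_⟩⟩
  have e₂ := h₂.trans (hd₂ s).symm
  refine hom_ext (by simpa using head f i ≫= e₂) fun k hk => ?_
  rcases (hij.le_of_lt hk).lt_or_eq with h | rfl
  · simpa using ι f h ≫= e₂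
  · exact h₁.trans (hd₁ s).symm

/-- The leg with index `i` already occurs at stage `Order.succ i`, which is below the limit `j`, so
a compatible family prescribes every leg. -/
lemma exists_desc_of_isSuccLimit [SuccOrder J] {j : J} (hj : Order.IsSuccLimit j) {T : C}
    (σ : ∀ i < j, (widePushoutChain f).obj i ⟶ T)
    (hσ : ∀ (i k : J) (hik : i ≤ k) (hk : k < j),
      (widePushoutChain f).map (homOfLE hik) ≫ σ k hk = σ i (hik.trans_lt hk)) :
    ∃ d : (widePushoutChain f).obj j ⟶ T, ∀ (i : J) (hi : i < j),
      (widePushoutChain f).map (homOfLE hi.le) ≫ d = σ i hi := by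
  obtain ⟨b, hb⟩ := not_isMin_iff.1 hj.not_isMin
  have hl {i : J} (hi : i < j) : i < Order.succ i := Order.lt_succ_of_not_isMax hi.not_isMax
  have hhead (i : J) (hi : i < j) : head f i ≫ σ i hi = head f b ≫ σ b hb := by
    rcases le_total i b with h | h
    · rw [← hσ _ _ h hb, head_map_assoc]
    · rw [← hσ _ _ h hi, head_map_assoc]
  have hι {i k : J} (hi : i < j) (hik : i < k) (hk : k < j) :
      ι f hik ≫ σ k hk = ι f (hl hi) ≫ σ _ (hj.succ_lt hi) := by
    rw [← hσ _ _ (Order.succ_le_of_lt hik) hk, ι_map_assoc]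
  obtain ⟨d, hd₀, hd⟩ := exists_desc (f := f) (j := j) (head f b ≫ σ b hb)
    (fun i hi => ι f (hl hi) ≫ σ _ (hj.succ_lt hi))
    (fun i hi => by rw [hom_ι_assoc, hhead _ (hj.succ_lt hi)])
  refine ⟨d, fun i hi => hom_ext ?_ fun k hk => ?_⟩
  · rw [head_map_assoc, hd₀, hhead _ hi]
  · rw [ι_map_assoc, hd, hι (hk.trans hi) hk hi]

lemma hom_ext_of_isSuccLimit [SuccOrder J] {j : J} (hj : Order.IsSuccLimit j) {T : C}
    {p q : (widePushoutChain f).obj j ⟶ T}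
    (h : ∀ (i : J) (hi : i < j), (widePushoutChain f).map (homOfLE hi.le) ≫ p =
      (widePushoutChain f).map (homOfLE hi.le) ≫ q) : p = q := by
  obtain ⟨b, hb⟩ := not_isMin_iff.1 hj.not_isMin
  refine hom_ext (by simpa using head f b ≫= h b hb) fun k hk => ?_
  simpa using ι f (Order.lt_succ_of_not_isMax hk.not_isMax) ≫= h _ (hj.succ_lt hk)

instance [WellFoundedLT J] : (widePushoutChain f).IsWellOrderContinuous where
  nonempty_isColimit j hj := by
    let : SuccOrder J := SuccOrder.ofLinearWellFoundedLT J
    have key (s : Cocone ((Set.principalSegIio j).monotone.functor ⋙ widePushoutChain f)) :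
        ∃ d : (widePushoutChain f).obj j ⟶ s.pt, ∀ (i : J) (hi : i < j),
          (widePushoutChain f).map (homOfLE hi.le) ≫ d = s.ι.app ⟨i, hi⟩ :=
      exists_desc_of_isSuccLimit hj (fun i hi => s.ι.app ⟨i, hi⟩) fun i k hik hk =>
        s.w (homOfLE hik : (⟨i, hik.trans_lt hk⟩ : Set.Iio j) ⟶ ⟨k, hk⟩)
    choose d hd using key
    exact ⟨⟨d, fun s i => hd s i i.2, fun s m hm => hom_ext_of_isSuccLimit hj fun i hi =>
      (hm ⟨i, hi⟩).trans (hd s i hi).symm⟩⟩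

instance [OrderBot J] : IsIso (head f (⊥ : J)) := by
  obtain ⟨d, hd, -⟩ := exists_desc (f := f) (j := ⊥) (𝟙 X) (fun i hi => (not_lt_bot hi).elim)
    (fun i hi => (not_lt_bot hi).elim)
  exact ⟨d, hd, hom_ext (by simp [reassoc_of% hd]) fun i hi => (not_lt_bot hi).elim⟩

end widePushoutChain

/-- Any small family of deducible morphisms with common domain admits a deducible morphism which
factors through all of its members. -/
lemma exists_deducible_amalgam {I : Type v} {Y : I → C} (f : ∀ i, X ⟶ Y i)
    (hf : ∀ i, deducible H (f i)) :
    ∃ (Z : C) (t : X ⟶ Z), deducible H t ∧ ∀ i, ∃ r : Y i ⟶ Z, f i ≫ r = t := by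
  obtain ⟨_, _⟩ := exists_wellFoundedLT I
  -- Stage `⊤` involves only the indices below `⊤`, hence exactly the given family; the identity is
  -- a filler value.
  let V : ∀ i, X ⟶ WithTop.recTopCoe (C := fun _ => C) X Y i := WithTop.recTopCoe (𝟙 X) f
  have hV : ∀ i, deducible H (V i) := by
    intro i
    induction i using WithTop.recTopCoe with
    | top => exact deducible_id X
    | coe i => exact hf i
  let : OrderBot (WithTop I) := WellFoundedLT.toOrderBot _
  refine ⟨_, widePushoutChain.head V ⊤, ?_, fun i =>
    ⟨widePushoutChain.ι V (WithTop.coe_lt_top i), widePushoutChain.hom_ι V (WithTop.coe_lt_top i)⟩⟩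
  rw [← widePushoutChain.head_map V (homOfLE (bot_le : (⊥ : WithTop I) ≤ ⊤))]
  exact (deducible H).comp_mem _ _ (deducible_of_isIso _)
    (deducible_chain _ _ fun i j hij => deducible_pushout (widePushoutChain.isPushout_map hij) (hV i))

end Amalgamation

/-! ### Left-proper factorization systems -/

namespace IsLeftProperFactorizationSystem

variable {E M : MorphismProperty C} (hEM : IsLeftProperFactorizationSystem E M)

include hEM

/-- Comparing with the factorization `𝟙 X ≫ (e ≫ m)` gives a retraction of the epimorphism `e`. -/
lemma isIso_of_comp {X Y Z : C} {e : X ⟶ Y} {m : Y ⟶ Z} (he : E e) (hm : M m)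
    (h : M (e ≫ m)) : IsIso e := by
  have := hEM.left_epi e he
  obtain ⟨d, ⟨hd, -⟩, -⟩ := hEM.diagonal e m (𝟙 X) (e ≫ m) he hm
    (hEM.left_of_isIso _ inferInstance) h (by simp)
  have : IsSplitMono e := .mk' ⟨d, hd⟩
  exact isIso_of_epi_of_isSplitMono e

lemma right_cancel {X Y Z : C} {f : X ⟶ Y} {g : Y ⟶ Z} (hg : M g) (h : M (f ≫ g)) : M f := by
  obtain ⟨S, e, m, he, hm, rfl⟩ := hEM.factor f
  have := hEM.isIso_of_comp he (hEM.right_comp _ _ hm hg) (by simpa using h)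
  exact hEM.right_comp _ _ (hEM.right_of_isIso _ this) hm

/-- If an `M`-morphism is a composite `ε ≫ r` with `ε` in `E`, then `ε` is an isomorphism. -/
lemma isIso_of_right_comp {X Y Z : C} {ε : X ⟶ Y} {r : Y ⟶ Z} (hε : E ε) (h : M (ε ≫ r)) :
    IsIso ε := by
  obtain ⟨S, a, b, ha, hb, rfl⟩ := hEM.factor r
  have := hEM.left_epi ε hε
  have := hEM.isIso_of_comp (hEM.left_comp _ _ hε ha) hb (by simpa using h)
  have : IsSplitMono ε := .mk' ⟨a ≫ inv (ε ≫ a), by rw [← Category.assoc, IsIso.hom_inv_id]⟩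
  exact isIso_of_epi_of_isSplitMono ε

end IsLeftProperFactorizationSystem

/-! ### Stable steps -/

/-- A morphism `t : X ⟶ X'` is a stable step if it is deducible from `H`, every morphism from the
domain of a member of `H` to `X` extends to `X'`, and the `E`-part of `t` is
not affected by a composition with further deducible morphisms. -/
structure IsStableStep (H E M : MorphismProperty C) {X X' S : C} (e : X ⟶ S) (m : S ⟶ X') :
    Prop where
  left : E e
  right ⦃Y : C⦄ (g : X' ⟶ Y) (hg : deducible H g) : M (m ≫ g)
  deducible : deducible H (e ≫ m)
  extend ⦃P Q : C⦄ (k : P ⟶ Q) (hk : H k) (f : P ⟶ X) : ∃ g : Q ⟶ X', k ≫ g = f ≫ e ≫ m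

variable {E M : MorphismProperty C}

/-- The `E`-quotient determined by an `E`-morphism. -/
def Quotients.mk {A B : C} (e : A ⟶ B) (he : E e) : Quotients E A :=
  Quotient.mk _ ⟨Under.mk e, he⟩

lemma Quotients.exists_of_mk_eq {A B B' : C} {e : A ⟶ B} {e' : A ⟶ B'} {he : E e} {he' : E e'}
    (h : Quotients.mk e he = Quotients.mk e' he') : ∃ r : B ⟶ B', e ≫ r = e' := by
  obtain ⟨i⟩ := Quotient.exact h
  exact ⟨i.hom.hom.right, Under.w i.hom.hom⟩

lemma exists_deducible_amalgam_of_small [HasColimitsOfSize.{v, v} C] {X : C} {I : Type w}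
    [Small.{v} I] {Y : I → C} (f : ∀ i, X ⟶ Y i) (hf : ∀ i, deducible H (f i)) :
    ∃ (Z : C) (t : X ⟶ Z), deducible H t ∧ ∀ i, ∃ r : Y i ⟶ Z, f i ≫ r = t := by
  obtain ⟨Z, t, ht, h⟩ := exists_deducible_amalgam (fun i => f ((equivShrink.{v} I).symm i))
    (fun i => hf _)
  exact ⟨Z, t, ht, fun i => by
    obtain ⟨i, rfl⟩ := (equivShrink.{v} I).symm.surjective i
    exact h i⟩

lemma IsStrongRanking.small_quotients (hR : IsStrongRanking E M) (A : C) :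
    Small.{v} (Quotients E A) := by
  obtain ⟨κ, _, hκ⟩ := hR.exists_rank A
  exact hκ.quotients_lt.small

/-- The step amalgamates the pushouts of members of `H` with one deducible morphism for each
`E`-quotient of `X` that is the `E`-part of some deducible morphism. It then factors through each
such quotient, so no later composition can enlarge its own `E`-part. Smallness of the set of
quotients makes the amalgam available. -/
lemma IsStrongRanking.exists_isStableStep (hR : IsStrongRanking E M)
    [MorphismProperty.IsSmall.{v} H] (X : C) :
    ∃ (X' S : C) (e : X ⟶ S) (m : S ⟶ X'), IsStableStep H E M e m := by
  have := hR.cocomplete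
  have := hR.small_quotients X
  have hEM := hR.leftProper
  let I₁ := Σ k : H.toSet, k.1.left ⟶ X
  let attained (q : Quotients E X) : Prop :=
    ∃ (S Y : C) (e : X ⟶ S) (m : S ⟶ Y) (he : E e), deducible H (e ≫ m) ∧ Quotients.mk e he = q
  choose S Y e m he hem hq using fun q : { q // attained q } => q.2
  have hI₁ (i : I₁) : deducible H (pushout.inr i.1.1.hom i.2) :=
    deducible_pushout (IsPushout.of_hasPushout _ _) (FormalConsequence.of_mem i.1.2)
  let Y' : I₁ ⊕ { q // attained q } → C := Sum.elim (fun i => pushout i.1.1.hom i.2) Y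
  let f : ∀ i, X ⟶ Y' i := Sum.rec (fun i => pushout.inr i.1.1.hom i.2) fun q => e q ≫ m q
  obtain ⟨X', t, ht, hft⟩ := exists_deducible_amalgam_of_small (H := H) f (by
    rintro (i | q)
    · exact hI₁ i
    · exact hem q)
  obtain ⟨S', e', m', he', hm', rfl⟩ := hEM.factor t
  refine ⟨X', S', e', m', he', ?_, ht, ?_⟩
  · intro Z g hg
    obtain ⟨T, ε, n, hε, hn, hεn⟩ := hEM.factor (m' ≫ g)
    have hε' := hEM.left_comp _ _ he' hε
    have hatt : attained (Quotients.mk (e' ≫ ε) hε') :=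
      ⟨T, Z, e' ≫ ε, n, hε', by
        simpa [hεn] using (deducible H).comp_mem _ _ ht hg, rfl⟩
    obtain ⟨r, hr⟩ : ∃ r : Y ⟨_, hatt⟩ ⟶ X', (e ⟨_, hatt⟩ ≫ m ⟨_, hatt⟩) ≫ r = e' ≫ m' :=
      hft (Sum.inr ⟨_, hatt⟩)
    obtain ⟨s, hs⟩ := Quotients.exists_of_mk_eq (hq ⟨_, hatt⟩).symm
    have := hEM.left_epi e' he'
    -- The quotient `e' ≫ ε` is attained, so the whole step factors through it; cancelling `e'`
    -- exhibits the `M`-morphism `m'` as starting with `ε`, which must be invertible.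
    have key : ε ≫ s ≫ m ⟨_, hatt⟩ ≫ r = m' := by
      rw [← cancel_epi e', ← hr, ← hs]
      simp
    have := hEM.isIso_of_right_comp hε (r := s ≫ m ⟨_, hatt⟩ ≫ r) (by rwa [key])
    rw [← hεn]
    exact hEM.right_comp _ _ (hEM.right_of_isIso _ this) hn
  · intro P Q k hk a
    obtain ⟨r, hr⟩ := hft (Sum.inl ⟨⟨Arrow.mk k, hk⟩, a⟩)
    refine ⟨pushout.inl k a ≫ r, ?_⟩
    rw [← hr]
    exact pushout.condition_assoc r

/-! ### Chains of stable steps -/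

section Chain

variable {J : Type v} [LinearOrder J] [SuccOrder J]

/-- The objects `S i` form a chain whose links `d` satisfy `d ≫ m j = m i ≫ F.map _`. Stability of
step `i` puts the right side in `M`, and `m j` in `M` can be cancelled, so `d` lies in `M`.
Precomposition with the epimorphisms `e i` identifies cocones on the two chains, so the colimits
agree and `hom(P, -)` preserves this one. -/
lemma exists_factor_through_stable_quotient (hEM : IsLeftProperFactorizationSystem E M) (F : J ⥤ C)
    (hF : ∀ {i j : J} (hij : i ≤ j), deducible H (F.map (homOfLE hij)))
    (S : J → C) (e : ∀ i, F.obj i ⟶ S i) (m : ∀ i, S i ⟶ F.obj (Order.succ i))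
    (hem : ∀ i, e i ≫ m i = F.map (homOfLE (Order.le_succ i)))
    (hs : ∀ i, IsStableStep H E M (e i) (m i)) (c : Cocone F) (hc : IsColimit c) (P : C)
    (hP : ∀ (G : J ⥤ C), (∀ ⦃i j : J⦄ (φ : i ⟶ j), M (G.map φ)) →
      PreservesColimit G (coyoneda.obj (op P))) (f : P ⟶ c.pt) :
    ∃ (i : J) (p : P ⟶ S i), f = p ≫ m i ≫ c.ι.app (Order.succ i) := by
  have epi (i : J) : Epi (e i) := hEM.left_epi _ (hs i).left
  have hd (i j : J) (hij : i ≤ j) : ∃ d : S i ⟶ S j, e i ≫ d = F.map (homOfLE hij) ≫ e j := by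
    rcases hij.lt_or_eq with h | rfl
    · refine ⟨m i ≫ F.map (homOfLE (Order.succ_le_of_lt h)) ≫ e j, ?_⟩
      rw [reassoc_of% (hem i), ← Functor.map_comp_assoc]
      rfl
    · exact ⟨𝟙 _, by simp⟩
  choose d hd using hd
  have hdm (i j : J) (hij : i ≤ j) : d i j hij ≫ m j =
      m i ≫ F.map (homOfLE (Order.succ_le_succ hij)) := by
    rw [← cancel_epi (e i), reassoc_of% (hd i j hij), hem, reassoc_of% (hem i),
      ← F.map_comp, ← F.map_comp]
    rfl
  let G : J ⥤ C :=
    { obj := S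
      map := fun {i j} φ => d i j (leOfHom φ)
      map_id := fun i => by
        rw [← cancel_epi (e i), hd, Category.comp_id]
        exact (F.map_id i =≫ e i).trans (Category.id_comp _)
      map_comp := fun {i j k} φ ψ => by
        rw [← cancel_epi (e i), hd, reassoc_of% (hd i j (leOfHom φ)), hd, ← F.map_comp_assoc]
        rfl }
  have hG : ∀ ⦃i j : J⦄ (φ : i ⟶ j), M (G.map φ) := by
    intro i j φ
    refine hEM.right_cancel (g := m j) ?_ ?_
    · simpa using (hs j).right (𝟙 _) (deducible_id _)
    · change M (d i j _ ≫ m j)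
      rw [hdm]
      exact (hs i).right _ (hF _)
  let c' : Cocone G :=
    { pt := c.pt
      ι :=
        { app := fun i => m i ≫ c.ι.app (Order.succ i)
          naturality := fun i j φ => by
            change d i j _ ≫ m j ≫ _ = _ ≫ 𝟙 _
            rw [reassoc_of% (hdm i j (leOfHom φ)), c.w, Category.comp_id] } }
  have hem' (i : J) : e i ≫ m i ≫ c.ι.app (Order.succ i) = c.ι.app i := by
    rw [reassoc_of% (hem i), c.w]
  let t (s : Cocone G) : Cocone F :=
    { pt := s.pt
      ι :=
        { app := fun i => e i ≫ s.ι.app i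
          naturality := fun i j φ => by
            change F.map φ ≫ e j ≫ _ = _ ≫ 𝟙 _
            rw [Category.comp_id, ← s.w φ]
            exact (reassoc_of% (hd i j (leOfHom φ))) _ |>.symm } }
  let hc' : IsColimit c' :=
    { desc := fun s => hc.desc (t s)
      fac := fun s i => by
        rw [← cancel_epi (e i)]
        change e i ≫ (m i ≫ c.ι.app _) ≫ hc.desc (t s) = e i ≫ s.ι.app i
        rw [← Category.assoc, hem']
        exact hc.fac (t s) i
      uniq := fun s g hg => hc.hom_ext fun i => by
        rw [hc.fac, ← hem', Category.assoc]
        exact congrArg (e i ≫ ·) (hg i) }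
  have := hP G hG
  obtain ⟨i, p, hp⟩ := Types.jointly_surjective_of_isColimit
    (isColimitOfPreserves (coyoneda.obj (op P)) hc') f
  exact ⟨i, p, hp.symm⟩

lemma injectiveWrt_of_chain (hEM : IsLeftProperFactorizationSystem E M) (F : J ⥤ C)
    (hF : ∀ {i j : J} (hij : i ≤ j), deducible H (F.map (homOfLE hij)))
    (hs : ∀ i : J, ∃ (S : C) (e : F.obj i ⟶ S) (m : S ⟶ F.obj (Order.succ i)),
      e ≫ m = F.map (homOfLE (Order.le_succ i)) ∧ IsStableStep H E M e m)
    (c : Cocone F) (hc : IsColimit c) {P Q : C} (k : P ⟶ Q) (hk : H k)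
    (hP : ∀ (G : J ⥤ C), (∀ ⦃i j : J⦄ (φ : i ⟶ j), M (G.map φ)) →
      PreservesColimit G (coyoneda.obj (op P))) : InjectiveWrt k c.pt := by
  choose S e m hem hs using hs
  intro f
  obtain ⟨i, p, rfl⟩ :=
    exists_factor_through_stable_quotient hEM F hF S e m hem hs c hc P hP f
  -- The map `p ≫ m i` lands in stage `Order.succ i`, so the extension is supplied by the next step.
  obtain ⟨g, hg⟩ := (hs _).extend k hk (p ≫ m i)
  refine ⟨g ≫ c.ι.app _, ?_⟩
  rw [reassoc_of% hg, reassoc_of% (hem (Order.succ i)), c.w]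

end Chain

/-! ### Weak reflections and completeness -/

lemma HasRank.preserves_of_le {κ κ' : Cardinal.{v}} [Fact κ.IsRegular] [Fact κ'.IsRegular]
    (h : κ ≤ κ') {A : C} (hA : HasRank E M κ A) (J : Type v) [SmallCategory J]
    [IsCardinalFiltered J κ'] (F : J ⥤ C) (hF : ∀ ⦃i j : J⦄ (f : i ⟶ j), M (F.map f)) :
    PreservesColimit F (coyoneda.obj (op A)) :=
  have := IsCardinalFiltered.of_le J h
  hA.preserves J F hF

lemma IsStrongRanking.exists_common_rank (hR : IsStrongRanking E M)
    [MorphismProperty.IsSmall.{v} H] :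
    ∃ (κ : Cardinal.{v}) (_ : Fact κ.IsRegular), ∀ ⦃P Q : C⦄ (k : P ⟶ Q), H k →
      ∀ (J : Type v) [SmallCategory J] [IsCardinalFiltered J κ] (F : J ⥤ C),
        (∀ ⦃i j : J⦄ (f : i ⟶ j), M (F.map f)) → PreservesColimit F (coyoneda.obj (op P)) := by
  choose κ hκ hr using hR.exists_rank
  -- A successor of an infinite cardinal is regular, and this one bounds the ranks of all domains of
  -- members of `H`.
  let κ' : Cardinal.{v} := Order.succ (max Cardinal.aleph0
    (⨆ k : Shrink.{v} H.toSet, κ ((equivShrink H.toSet).symm k).1.left))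
  refine ⟨κ', ⟨Cardinal.isRegular_succ (le_max_left _ _)⟩, fun P Q k hk J _ _ F hF => ?_⟩
  have : Fact κ'.IsRegular := ⟨Cardinal.isRegular_succ (le_max_left _ _)⟩
  refine (hr P).preserves_of_le (κ' := κ') ?_ J F hF
  refine le_trans ?_ ((le_max_right _ _).trans (Order.le_succ _))
  have := le_ciSup (f := fun k : Shrink.{v} H.toSet => κ ((equivShrink H.toSet).symm k).1.left)
    Cardinal.bddAbove_of_small (equivShrink H.toSet ⟨Arrow.mk k, hk⟩)
  simpa using this

/-- A linear order as the proper principal segment of the order obtained by adding a top element. -/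
@[simps]
def withTopPrincipalSeg (J : Type v) [LinearOrder J] : J <i WithTop J where
  toFun := (↑)
  inj' := WithTop.coe_injective
  map_rel_iff' := WithTop.coe_lt_coe
  top := ⊤
  mem_range_iff_rel' b := by
    induction b using WithTop.recTopCoe <;> simp

/-- In a strongly locally ranked category, every object admits a deducible morphism to an object
which is injective with respect to `H`. -/
lemma IsStrongRanking.exists_deducible_to_injective (hR : IsStrongRanking E M)
    [MorphismProperty.IsSmall.{v} H] (A : C) :
    ∃ (X : C) (t : A ⟶ X), deducible H t ∧
      ∀ ⦃P Q : C⦄ (k : P ⟶ Q), H k → InjectiveWrt k X := by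
  have := hR.cocomplete
  obtain ⟨κ, hκ, hP⟩ := hR.exists_common_rank (H := H)
  choose T S e m hs using hR.exists_isStableStep (H := H)
  let Φ : SmallObject.SuccStruct C := ⟨A, T, fun X => e X ≫ m X⟩
  let J := κ.ord.ToType
  have : NoMaxOrder J := Cardinal.noMaxOrder hκ.out.aleph0_le
  have : Nonempty J := IsCardinalFiltered.nonempty J κ
  let : SuccOrder J := SuccOrder.ofLinearWellFoundedLT J
  let : OrderBot (WithTop J) := WellFoundedLT.toOrderBot _
  let : SuccOrder (WithTop J) := SuccOrder.ofLinearWellFoundedLT _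
  -- The added top is a limit, as `J` has no maximum; the value there is the colimit of the
  -- `κ`-filtered chain over `J`.
  let F : WithTop J ⥤ C := Φ.iterationFunctor (WithTop J)
  have hΦ {X Y : C} (f : X ⟶ Y) (hf : Φ.prop f) :
      ∃ (S : C) (e : X ⟶ S) (m : S ⟶ Y), e ≫ m = f ∧ IsStableStep H E M e m := by
    cases hf
    exact ⟨_, e _, m _, rfl, hs _⟩
  have hsucc {i j : WithTop J} (hij : i ⋖ j) : Φ.prop (F.map (homOfLE hij.le)) := by
    obtain rfl := hij.succ_eq
    exact Φ.prop_iterationFunctor_map_succ i hij.lt.not_isMax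
  have hded {i j : WithTop J} (hij : i ≤ j) : deducible H (F.map (homOfLE hij)) := by
    refine deducible_chain_map (WithTop J) F (fun j hj => ?_) hij
    obtain ⟨_, _, _, h, hs⟩ := hΦ _ (hsucc (Order.covBy_succ_of_not_isMax hj))
    rw [← h]
    exact hs.deducible
  have htop : Order.IsSuccLimit (⊤ : WithTop J) := by
    refine ⟨fun h => ?_, fun i hi => ?_⟩
    · exact (WithTop.coe_lt_top (Classical.arbitrary J)).not_ge (h le_top)
    · induction i using WithTop.recTopCoe with
      | top => exact hi.lt.ne rfl
      | coe i =>
        obtain ⟨j, hj⟩ := exists_gt i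
        exact hi.2 (WithTop.coe_lt_coe.2 hj) (WithTop.coe_lt_top j)
  refine ⟨F.obj ⊤, (Φ.iterationFunctorObjBotIso (WithTop J)).inv ≫ F.map (homOfLE bot_le),
    (deducible H).comp_mem _ _ (deducible_of_isIso _) (hded _), fun P Q k hk => ?_⟩
  exact injectiveWrt_of_chain hR.leftProper
    ((withTopPrincipalSeg J).monotone.functor ⋙ F) (fun hij => hded (WithTop.coe_le_coe.2 hij))
    (fun i => hΦ _ (hsucc (WithTop.coe_covBy_coe.2 (Order.covBy_succ i))))
    _ (F.isColimitOfIsWellOrderContinuous' (withTopPrincipalSeg J) htop) k hk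
    (fun G hG => hP k hk J G hG)

lemma InjectivityConsequence.formalConsequence (hC : StronglyLocallyRanked C)
    [MorphismProperty.IsSmall.{v} H] {A B : C} {h : A ⟶ B} (hh : InjectivityConsequence H h) :
    FormalConsequence H h := by
  obtain ⟨E, M, hR⟩ := hC
  obtain ⟨X, t, ht, hX⟩ := hR.exists_deducible_to_injective (H := H) A
  obtain ⟨g, rfl⟩ := hh X hX t
  exact deducible_cancel ht

end InjectivityLogic

theorem corollary6p7 {C : Type u} [Category.{v} C]
    (hC : InjectivityLogic.StronglyLocallyRanked C)
    (H : MorphismProperty C) [MorphismProperty.IsSmall.{v} H] {A B : C} (h : A ⟶ B) :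
    InjectivityLogic.InjectivityConsequence H h ↔ InjectivityLogic.FormalConsequence H h :=
  ⟨fun hh => hh.formalConsequence hC, fun hh => hh.injectivityConsequence⟩
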